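/- Let $G$ be a compact Hausdorff topological group with normalized Haar measure $\mu$ (the regular Haar probability measure on the Borel sets of $G$), and let $L^2(G)=L^2(G,\mu)$ consist of complex-valued functions. Vector spaces are complex, and inner products $\langle\cdot,\cdot\rangle$ on representation spaces are linear in the first variable. A unitary representation of $G$ on a Hilbert space $H$ is a homomorphism $\pi$ from $G$ to the unitary group of $H$ such that $x\mapsto\pi(x)v$ is continuous for every $v\in H$; it is irreducible if $H\neq 0$ and the only closed invariant subspaces are $0$ and $H$. For $v,w\in H$ the matrix coefficient $\varphi^{\pi}_{v,w}\in C(G)$ is $\varphi^{\pi}_{v,w}(x)=\langle\pi(x)v,w\rangle$. Let $\mathcal A(G)\subseteq C(G)$ be the complex linear span of all matrix coefficients of all finite-dimensional unitary representations of $G$, and let $\widehat G$ be the unitary dual, the set of unitary equivalence classes of irreducible unitary representations of $G$ on Hilbert spaces. 1. Every continuous representation of $G$ on a finite-dimensional complex vector space is equivalent (by an invertible linear intertwining map) to a unitary representation on a finite-dimensional Hilbert space. 2. $\mathcal A(G)$ is a $*$-subalgebra of $C(G)$ (for pointwise operations and complex conjugation), contains the constants, separates the points of $G$, and is uniformly dense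 in $C(G)$. 3. Every irreducible unitary representation of $G$ on a Hilbert space is finite-dimensional. Choose, in any way, a representative $\pi$ on $H_\pi$ of each class in $\widehat G$ and an orthonormal basis $e^{\pi}_1,\dots,e^{\pi}_{d_\pi}$ of $H_\pi$, where $d_\pi=\dim H_\pi$. Then the functions $\sqrt{d_\pi}\,\varphi^{\pi}_{e^{\pi}_i,e^{\pi}_j}$ ($\pi\in\widehat G$, $1\le i,j\le d_\pi$) form an orthonormal basis of $L^2(G)$. 4. For every choice of representatives as in 3 there is a unitary isomorphism $$\widehat{\bigoplus}_{\pi\in\widehat G} H_\pi\otimes H_\pi^{*}\;\cong\; L^2(G)$$ from the Hilbert direct sum (where $H_\pi^*$ is the dual Hilbert space and $H_\pi\otimes H_\pi^*$ the Hilbert space tensor product) onto $L^2(G)$ that sends $v\otimes\langle\cdot,w\rangle$ in the summand of $\pi$ to $\sqrt{d_\pi}\,\varphi^{\pi}_{v,w}$, for all $v,w\in H_\pi$. -/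

import Mathlib

open MeasureTheory
open scoped TensorProduct InnerProductSpace

universe u v

/-- A (strongly continuous) unitary representation of a topological group `G` on a complex inner
product space `H`: a homomorphism into the group of surjective linear isometries of `H` all of
whose orbit maps are continuous. If `H` is finite-dimensional this is the same as a continuous
homomorphism into the unitary group of `H`. -/
structure UnitaryRep (G : Type u) [Group G] [TopologicalSpace G]
    (H : Type v) [NormedAddCommGroup H] [InnerProductSpace ℂ H] where
  toHom : G →* (H ≃ₗᵢ[ℂ] H)
  continuous_apply : ∀ v : H, Continuous fun g : G => toHom g v

namespace UnitaryRep

variable {G : Type u} [Group G] [TopologicalSpace G]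
variable {H : Type v} [NormedAddCommGroup H] [InnerProductSpace ℂ H]

/-- Irreducibility: `H` is nonzero and its only closed invariant subspaces are `0` and `H`. -/
def IsIrreducible (π : UnitaryRep G H) : Prop :=
  Nontrivial H ∧ ∀ K : Submodule ℂ H, IsClosed (K : Set H) →
    (∀ g : G, ∀ v ∈ K, π.toHom g v ∈ K) → K = ⊥ ∨ K = ⊤

/-- Unitary equivalence. -/
def UnitaryEquiv {H' : Type v} [NormedAddCommGroup H'] [InnerProductSpace ℂ H']
    (π : UnitaryRep G H) (π' : UnitaryRep G H') : Prop :=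
  ∃ T : H ≃ₗᵢ[ℂ] H', ∀ (g : G) (v : H), T (π.toHom g v) = π'.toHom g (T v)

/-- The matrix coefficient `x ↦ ⟨π(x)v, w⟩`, where `⟨·,·⟩` is linear in its first variable
(Mathlib's inner product is linear in the second one). -/
noncomputable def matrixCoeff (π : UnitaryRep G H) (v w : H) : C(G, ℂ) where
  toFun x := inner ℂ w (π.toHom x v)
  continuous_toFun := continuous_const.inner (π.continuous_apply v)

end UnitaryRep

/-- The complex linear span of all matrix coefficients of all finite-dimensional continuous
unitary representations of `G`. -/
noncomputable def matrixCoeffSpan (G : Type u) [Group G] [TopologicalSpace G] : Submodule ℂ C(G, ℂ) :=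
  Submodule.span ℂ {f | ∃ (V : Type v) (_ : NormedAddCommGroup V) (_ : InnerProductSpace ℂ V)
    (_ : FiniteDimensional ℂ V) (π : UnitaryRep G V) (a b : V), f = π.matrixCoeff a b}

/-- An irreducible unitary representation of `G` on some complex Hilbert space. -/
structure IrredUnitaryRep (G : Type u) [Group G] [TopologicalSpace G] where
  space : Type v
  [normed : NormedAddCommGroup space]
  [innerProd : InnerProductSpace ℂ space]
  [complete : CompleteSpace space]
  rep : UnitaryRep G space
  irreducible : rep.IsIrreducible

attribute [instance] IrredUnitaryRep.normed IrredUnitaryRep.innerProd IrredUnitaryRep.complete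

instance irredUnitaryRepSetoid (G : Type u) [Group G] [TopologicalSpace G] :
    Setoid (IrredUnitaryRep.{u, v} G) where
  r σ τ := σ.rep.UnitaryEquiv τ.rep
  iseqv :=
    { refl := fun _ => ⟨LinearIsometryEquiv.refl ℂ _, fun _ _ => rfl⟩
      symm := by
        rintro σ τ ⟨T, hT⟩
        refine ⟨T.symm, fun g w => ?_⟩
        rw [LinearIsometryEquiv.symm_apply_eq, hT, LinearIsometryEquiv.apply_symm_apply]
      trans := by
        rintro σ τ ρ ⟨T, hT⟩ ⟨S, hS⟩
        refine ⟨T.trans S, fun g w => ?_⟩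
        simp [hT, hS] }

/-- The unitary dual of `G`: unitary equivalence classes of irreducible unitary representations
of `G` on complex Hilbert spaces. -/
def UnitaryDual (G : Type u) [Group G] [TopologicalSpace G] : Type (max u (v + 1)) :=
  Quotient (irredUnitaryRepSetoid.{u, v} G)

/-- The class of an irreducible unitary representation in the unitary dual. -/
def IrredUnitaryRep.toUnitaryDual {G : Type u} [Group G] [TopologicalSpace G]
    (σ : IrredUnitaryRep.{u, v} G) : UnitaryDual.{u, v} G :=
  Quotient.mk (irredUnitaryRepSetoid.{u, v} G) σ

/-- The Hilbert space structure of the dual `H*` of a Hilbert space `H` (for the operator norm):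
`⟨φ_v, φ_w⟩ = ⟨w, v⟩` if `φ_v`, `φ_w` are the functionals represented by `v`, `w`. -/
noncomputable instance strongDualInnerProductSpace (H : Type v) [NormedAddCommGroup H]
    [InnerProductSpace ℂ H] [CompleteSpace H] : InnerProductSpace ℂ (StrongDual ℂ H) where
  inner φ ψ := inner ℂ ((InnerProductSpace.toDual ℂ H).symm ψ)
    ((InnerProductSpace.toDual ℂ H).symm φ)
  norm_sq_eq_re_inner φ := by
    rw [inner_self_eq_norm_sq, LinearIsometryEquiv.norm_map]
  conj_inner_symm φ ψ := inner_conj_symm _ _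
  add_left φ ψ χ := by rw [map_add, inner_add_right]
  smul_left φ ψ r := by rw [map_smulₛₗ, inner_smul_right]

-- Everything rests on averaging over `G`. For unitary representations `π`, `π'`, the operator
-- `averageRankOne`, `b ↦ ∫ ⟪π(x)a, b⟫ π'(x)a' dμ`, intertwines `π` with `π'`. For `π = π'` and `a =
-- a'` it is compact and self-adjoint, so its eigenspaces for nonzero eigenvalues are
-- finite-dimensional and invariant. If `a` is orthogonal to all of these, the operator kills `a`,
-- so `∫ |⟪π(x)a, a⟫|² dμ = 0` and `a = 0`. This is `eq_zero_of_forall_mem_orthogonal`. For an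
-- irreducible `π` it gives finite dimension. For the regular representation on `L²(G)`, which is
-- faithful, it shows that finite-dimensional representations separate points.
--
-- The span of coefficients is closed under products (tensor products) and conjugation (duals), so
-- Stone–Weierstrass makes it dense in `C(G)`, hence in `L²(G)`. Splitting into irreducibles shows
-- that representatives of the dual suffice. In finite dimension Schur's lemma applies to the same
-- averaged operators: they vanish between inequivalent irreducibles and are scalars, determined by
-- their trace, on a single one. These are the orthogonality relations, which with density give the
-- orthonormal basis and the Hilbert sum. Unitarization averages an arbitrary inner product.

universe w

namespace UnitaryRep

/-! ### Restriction, transport, tensor product and dual; their coefficients. -/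

section Constructions

variable {G : Type u} [Group G] [TopologicalSpace G]
variable {H : Type v} [NormedAddCommGroup H] [InnerProductSpace ℂ H]
variable {H' : Type w} [NormedAddCommGroup H'] [InnerProductSpace ℂ H']

/-- A linear representation by isometries with continuous orbit maps is a unitary representation. -/
noncomputable def ofRepresentation (ρ : Representation ℂ G H) (hρ : ∀ g a, ‖ρ g a‖ = ‖a‖)
    (hc : ∀ a, Continuous fun g => ρ g a) : UnitaryRep G H where
  toHom :=
    { toFun g :=
        { toLinearEquiv := LinearEquiv.ofLinearMap (ρ g) (ρ g⁻¹)
            (by rw [← Module.End.mul_eq_comp, ← map_mul]; simp; rfl)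
            (by rw [← Module.End.mul_eq_comp, ← map_mul]; simp; rfl)
          norm_map' := hρ g }
      map_one' := by ext a; change ρ 1 a = a; simp
      map_mul' g h := by ext a; change ρ (g * h) a = ρ g (ρ h a); simp }
  continuous_apply := hc

@[simp]
lemma ofRepresentation_apply (ρ : Representation ℂ G H) (hρ : ∀ g a, ‖ρ g a‖ = ‖a‖)
    (hc : ∀ a, Continuous fun g => ρ g a) (g : G) (a : H) :
    (ofRepresentation ρ hρ hc).toHom g a = ρ g a := rfl

@[simp]
lemma matrixCoeff_apply (π : UnitaryRep G H) (a b : H) (x : G) :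
    π.matrixCoeff a b x = inner ℂ b (π.toHom x a) := rfl

lemma toHom_mul_apply (π : UnitaryRep G H) (g h : G) (a : H) :
    π.toHom (g * h) a = π.toHom g (π.toHom h a) := by simp

@[simp]
lemma toHom_inv_apply_apply (π : UnitaryRep G H) (g : G) (a : H) :
    π.toHom g⁻¹ (π.toHom g a) = a := by rw [← toHom_mul_apply]; simp

lemma inner_toHom_left (π : UnitaryRep G H) (g : G) (a b : H) :
    inner ℂ (π.toHom g a) b = inner ℂ a (π.toHom g⁻¹ b) := by
  rw [← (π.toHom g⁻¹).inner_map_map, toHom_inv_apply_apply]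

lemma inner_toHom_right (π : UnitaryRep G H) (g : G) (a b : H) :
    inner ℂ a (π.toHom g b) = inner ℂ (π.toHom g⁻¹ a) b := by
  rw [inner_toHom_left, inv_inv]

/-- The underlying linear representation. -/
noncomputable def toRepresentation (π : UnitaryRep G H) : Representation ℂ G H where
  toFun g := (π.toHom g).toLinearEquiv.toLinearMap
  map_one' := by ext; simp
  map_mul' g h := by ext; simp

@[simp]
lemma toRepresentation_apply (π : UnitaryRep G H) (g : G) (a : H) :
    π.toRepresentation g a = π.toHom g a := rfl

/-- A subspace is invariant if all operators of the representation map it to itself. -/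
def IsInvariant (π : UnitaryRep G H) (K : Submodule ℂ H) : Prop :=
  ∀ g : G, ∀ a ∈ K, π.toHom g a ∈ K

lemma IsInvariant.orthogonal {π : UnitaryRep G H} {K : Submodule ℂ H} (hK : π.IsInvariant K) :
    π.IsInvariant Kᗮ := fun g a ha b hb => by
  rw [inner_toHom_right]
  exact ha _ (hK _ _ hb)

/-- The restriction of a unitary representation to an invariant subspace. -/
noncomputable def restrict (π : UnitaryRep G H) (K : Submodule ℂ H) (hK : π.IsInvariant K) :
    UnitaryRep G K :=
  ofRepresentation
    { toFun g := (π.toRepresentation g).restrict (hK g)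
      map_one' := by ext; simp
      map_mul' g h := by ext a; exact toHom_mul_apply π g h a }
    (fun g a => (π.toHom g).norm_map a)
    (fun a => by
      refine Continuous.subtype_mk (f := fun g => π.toHom g a) (π.continuous_apply a) _)

@[simp]
lemma coe_restrict_apply (π : UnitaryRep G H) (K : Submodule ℂ H) (hK : π.IsInvariant K)
    (g : G) (a : K) : ((π.restrict K hK).toHom g a : H) = π.toHom g a := rfl

@[simp]
lemma matrixCoeff_restrict (π : UnitaryRep G H) (K : Submodule ℂ H) (hK : π.IsInvariant K)
    (a b : K) : (π.restrict K hK).matrixCoeff a b = π.matrixCoeff a b := by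
  ext x; simp

/-- The transport of a unitary representation along a linear isometric equivalence. -/
noncomputable def transport (π : UnitaryRep G H) (e : H ≃ₗᵢ[ℂ] H') : UnitaryRep G H' :=
  ofRepresentation
    { toFun g := e.toLinearEquiv.toLinearMap ∘ₗ π.toRepresentation g ∘ₗ
        e.symm.toLinearEquiv.toLinearMap
      map_one' := by ext; simp
      map_mul' g h := by ext; simp }
    (fun g a => by simp)
    (fun a => e.continuous.comp (π.continuous_apply _))

@[simp]
lemma transport_apply (π : UnitaryRep G H) (e : H ≃ₗᵢ[ℂ] H') (g : G) (a : H') :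
    (π.transport e).toHom g a = e (π.toHom g (e.symm a)) := rfl

lemma matrixCoeff_transport (π : UnitaryRep G H) (e : H ≃ₗᵢ[ℂ] H') (a b : H) :
    (π.transport e).matrixCoeff (e a) (e b) = π.matrixCoeff a b := by
  ext x; simp

/-- The tensor product of two unitary representations. -/
noncomputable def tensor (π : UnitaryRep G H) (π' : UnitaryRep G H') : UnitaryRep G (H ⊗[ℂ] H') :=
  ofRepresentation (π.toRepresentation.tprod π'.toRepresentation)
    (fun g a => TensorProduct.norm_map (π.toHom g).toLinearIsometry (π'.toHom g).toLinearIsometry a)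
    (fun a => by
      induction a with
      | zero => simpa using continuous_const
      | add a b ha hb => simp only [map_add]; exact ha.add hb
      | tmul a b =>
        exact TensorProduct.continuous_tmul.comp
          ((π.continuous_apply a).prodMk (π'.continuous_apply b)))

lemma matrixCoeff_tensor (π : UnitaryRep G H) (π' : UnitaryRep G H') (a b : H) (a' b' : H') :
    (π.tensor π').matrixCoeff (a ⊗ₜ a') (b ⊗ₜ b') = π.matrixCoeff a b * π'.matrixCoeff a' b' := by
  ext x; exact TensorProduct.inner_tmul (𝕜 := ℂ) b (π.toHom x a) b' (π'.toHom x a')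

/-- The dual of a unitary representation. -/
noncomputable def dual [CompleteSpace H] (π : UnitaryRep G H) : UnitaryRep G (StrongDual ℂ H) :=
  ofRepresentation
    { toFun g :=
        { toFun φ := InnerProductSpace.toDual ℂ H
            (π.toHom g ((InnerProductSpace.toDual ℂ H).symm φ))
          map_add' φ ψ := by simp
          map_smul' c φ := by rw [map_smulₛₗ, map_smul, map_smulₛₗ]; simp }
      map_one' := by ext; simp
      map_mul' g h := by ext; simp }
    (fun g a => by simp)
    (fun a => (InnerProductSpace.toDual ℂ H).continuous.comp (π.continuous_apply _))

lemma matrixCoeff_dual [CompleteSpace H] (π : UnitaryRep G H) (a b : H) :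
    π.dual.matrixCoeff (InnerProductSpace.toDual ℂ H a) (InnerProductSpace.toDual ℂ H b) =
      star (π.matrixCoeff a b) := by
  ext x
  change inner ℂ ((InnerProductSpace.toDual ℂ H).symm (InnerProductSpace.toDual ℂ H _))
    ((InnerProductSpace.toDual ℂ H).symm _) = _
  simp

lemma matrixCoeff_add_left (π : UnitaryRep G H) (a a' b : H) :
    π.matrixCoeff (a + a') b = π.matrixCoeff a b + π.matrixCoeff a' b := by
  ext x; simp

lemma matrixCoeff_add_right (π : UnitaryRep G H) (a b b' : H) :
    π.matrixCoeff a (b + b') = π.matrixCoeff a b + π.matrixCoeff a b' := by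
  ext x; simp

lemma matrixCoeff_smul_left (π : UnitaryRep G H) (c : ℂ) (a b : H) :
    π.matrixCoeff (c • a) b = c • π.matrixCoeff a b := by
  ext x; simp

lemma matrixCoeff_smul_right (π : UnitaryRep G H) (c : ℂ) (a b : H) :
    π.matrixCoeff a (c • b) = star c • π.matrixCoeff a b := by
  ext x; simp [mul_comm]

/-- Matrix coefficients as a sesquilinear map. -/
noncomputable def matrixCoeffₛₗ (π : UnitaryRep G H) : H →ₗ[ℂ] H →ₗ⋆[ℂ] C(G, ℂ) :=
  LinearMap.mk₂'ₛₗ _ _ π.matrixCoeff π.matrixCoeff_add_left π.matrixCoeff_smul_left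
    π.matrixCoeff_add_right π.matrixCoeff_smul_right

@[simp]
lemma matrixCoeffₛₗ_apply (π : UnitaryRep G H) (a b : H) :
    π.matrixCoeffₛₗ a b = π.matrixCoeff a b := rfl

lemma matrixCoeff_eq_sum {ι : Type*} [Fintype ι] (π : UnitaryRep G H)
    (e : OrthonormalBasis ι ℂ H) (a b : H) :
    π.matrixCoeff a b =
      ∑ i, ∑ j, (e.repr a i * star (e.repr b j)) • π.matrixCoeff (e i) (e j) := by
  rw [← matrixCoeffₛₗ_apply]
  conv_lhs => rw [← e.sum_repr a, ← e.sum_repr b]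
  rw [Finset.sum_comm]
  simp [map_sum, LinearMap.sum_apply, Finset.smul_sum, smul_smul, mul_comm]

end Constructions

/-! ### The left regular representation. -/

section Regular

variable {G : Type u} [Group G] [TopologicalSpace G] [IsTopologicalGroup G]
  [CompactSpace G] [MeasurableSpace G] [BorelSpace G]
  (μ : Measure G) [μ.IsMulLeftInvariant] [μ.Regular]

/-- The left regular representation on `L²(G)`. -/
noncomputable def regular : UnitaryRep G (Lp ℂ 2 μ) :=
  ofRepresentation
    { toFun g :=
        -- `DomMulAct.mk` reverses products; the inverse restores a left action, `(g f)(x) =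
        -- f(g⁻¹x)`.
        { toFun f := DomMulAct.mk g⁻¹ • f
          map_add' := smul_add _
          map_smul' c f := smul_comm _ c f }
      map_one' := by ext1 f; simp
      map_mul' g h := by
        ext1 f
        change DomMulAct.mk (g * h)⁻¹ • f = DomMulAct.mk g⁻¹ • DomMulAct.mk h⁻¹ • f
        rw [smul_smul, mul_inv_rev, DomMulAct.mk_mul] }
    (fun g f => DomMulAct.norm_smul_Lp _ _)
    (fun f => by
      have : Fact ((2 : ENNReal) ≠ ⊤) := ⟨by simp⟩
      exact (DomMulAct.continuous_mk.comp continuous_inv).smul continuous_const)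

lemma regular_toLp_ae_eq (g : G) (f : C(G, ℂ)) :
    (regular μ).toHom g (ContinuousMap.toLp 2 μ ℂ f) =ᵐ[μ] fun x => f (g⁻¹ * x) := by
  refine (DomMulAct.smul_Lp_ae_eq (DomMulAct.mk g⁻¹) _).trans ?_
  exact (measurePreserving_mul_left μ g⁻¹).quasiMeasurePreserving.ae_eq_comp
    (ContinuousMap.coeFn_toLp μ f)

end Regular

end UnitaryRep

namespace UnitaryRep

/-! ### Averaged rank-one operators and finite-dimensional invariant subspaces. -/

section Averaging

variable {G : Type*} [Group G] [TopologicalSpace G] [CompactSpace G]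
  [MeasurableSpace G] [BorelSpace G] (μ : Measure G) [IsProbabilityMeasure μ]
variable {H : Type*} [NormedAddCommGroup H] [InnerProductSpace ℂ H]
variable {H' : Type*} [NormedAddCommGroup H'] [InnerProductSpace ℂ H']

omit [Group G] in
lemma integrable_of_continuous {E : Type*} [NormedAddCommGroup E] {f : G → E}
    (hf : Continuous f) : Integrable f μ :=
  hf.integrable_of_hasCompactSupport (HasCompactSupport.of_compactSpace _)

-- Continuity in operator norm, not only pointwise, makes the average a Bochner integral in `H →L[ℂ]
-- H'`, so that it stays in closed subspaces such as the compact operators.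
omit [CompactSpace G] [MeasurableSpace G] [BorelSpace G] in
lemma continuous_rankOne (π : UnitaryRep G H) (π' : UnitaryRep G H') (a : H) (a' : H') :
    Continuous fun x => InnerProductSpace.rankOne ℂ (π'.toHom x a') (π.toHom x a) :=
  (ContinuousLinearMap.smulRightL ℂ H H').continuous₂.comp
    (((innerSL ℂ).continuous.comp (π.continuous_apply a)).prodMk (π'.continuous_apply a'))

/-- The average over the group of the rank-one operators `⟨·, π(x)a⟩ π'(x)a'`. -/
noncomputable def averageRankOne (π : UnitaryRep G H) (π' : UnitaryRep G H') (a : H) (a' : H') :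
    H →L[ℂ] H' :=
  ∫ x, InnerProductSpace.rankOne ℂ (π'.toHom x a') (π.toHom x a) ∂μ

lemma averageRankOne_apply (π : UnitaryRep G H) (π' : UnitaryRep G H') (a : H) (a' : H') (b : H) :
    averageRankOne μ π π' a a' b = ∫ x, inner ℂ (π.toHom x a) b • π'.toHom x a' ∂μ :=
  ContinuousLinearMap.integral_apply
    (integrable_of_continuous μ (continuous_rankOne π π' a a')) b

lemma inner_averageRankOne_apply [CompleteSpace H'] (π : UnitaryRep G H) (π' : UnitaryRep G H')
    (a : H) (a' : H') (b : H) (b' : H') :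
    inner ℂ b' (averageRankOne μ π π' a a' b) =
      ∫ x, inner ℂ (π.toHom x a) b * inner ℂ b' (π'.toHom x a') ∂μ := by
  rw [averageRankOne_apply, ← integral_inner]
  · simp [inner_smul_right]
  · exact integrable_of_continuous μ
      (((π.continuous_apply a).inner continuous_const).smul (π'.continuous_apply a'))

/-- Left invariance allows the substitution `x ↦ gx`; the unitary `π'(g)` then comes out of the
integral. -/
lemma averageRankOne_toHom_apply [IsTopologicalGroup G] [CompleteSpace H'] [μ.IsMulLeftInvariant]
    (π : UnitaryRep G H) (π' : UnitaryRep G H') (a : H) (a' : H') (g : G) (b : H) :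
    averageRankOne μ π π' a a' (π.toHom g b) = π'.toHom g (averageRankOne μ π π' a a' b) := by
  simp only [averageRankOne_apply]
  rw [← integral_mul_left_eq_self _ g]
  refine Eq.trans ?_ ((π'.toHom g).toLinearIsometry.integral_comp_comm _)
  simp

/-- Rank-one operators are compact, and an average cannot leave a closed convex set. -/
lemma isCompactOperator_averageRankOne [CompleteSpace H'] (π : UnitaryRep G H)
    (π' : UnitaryRep G H') (a : H) (a' : H') : IsCompactOperator (averageRankOne μ π π' a a') := by
  have hint := integrable_of_continuous μ (continuous_rankOne π π' a a')
  let S : Submodule ℂ (H →L[ℂ] H') := compactOperator (RingHom.id ℂ) H H'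
  have hS : IsClosed (S : Set (H →L[ℂ] H')) := isClosed_setOfPred_isCompactOperator
  refine Convex.integral_mem (s := (S : Set (H →L[ℂ] H')))
    (S.restrictScalars ℝ).convex hS (.of_forall fun x => ?_) hint
  change IsCompactOperator (InnerProductSpace.rankOne ℂ (π'.toHom x a') (π.toHom x a))
  rw [InnerProductSpace.rankOne_def']
  exact (isCompactOperator_of_locallyCompactSpace_rng
    (ContinuousLinearMap.toSpanSingleton ℂ (π'.toHom x a'))).comp_clm _

lemma isSymmetric_averageRankOne [CompleteSpace H] (π : UnitaryRep G H) (a : H) :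
    (averageRankOne μ π π a a : H →ₗ[ℂ] H).IsSymmetric := fun b c => by
  rw [← inner_conj_symm, ContinuousLinearMap.coe_coe, inner_averageRankOne_apply,
    inner_averageRankOne_apply, ← integral_conj]
  simp [mul_comm]

/-- In a unitary representation of a compact group, a vector orthogonal to all finite-dimensional
invariant subspaces vanishes. -/
theorem eq_zero_of_forall_mem_orthogonal [IsTopologicalGroup G] [μ.IsMulLeftInvariant]
    [μ.IsOpenPosMeasure] [CompleteSpace H] (π : UnitaryRep G H) (a : H)
    (ha : ∀ K : Submodule ℂ H, FiniteDimensional ℂ K → π.IsInvariant K → a ∈ Kᗮ) : a = 0 := by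
  set T := averageRankOne μ π π a a with hT
  have hsymm := isSymmetric_averageRankOne μ π a
  have hcomp : IsCompactOperator T := isCompactOperator_averageRankOne μ π π a a
  -- By the spectral theorem it is enough that `T a` is orthogonal to each eigenspace. For `b` of
  -- eigenvalue `c`, symmetry turns `⟪b, T a⟫` into a multiple of `⟪b, a⟫` by the conjugate of `c`:
  -- this is zero if `c = 0`, and otherwise `ha` applies to the eigenspace.
  have hTa : T a = 0 := by
    have hbot := ContinuousLinearMap.orthogonalComplement_iSup_eigenspaces_eq_bot hcomp hsymm
    rw [← Submodule.mem_bot ℂ, ← hbot, ← Submodule.iInf_orthogonal, Submodule.mem_iInf]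
    intro c b hb
    rw [Module.End.mem_eigenspace_iff] at hb
    rw [← ContinuousLinearMap.coe_coe, ← hsymm, hb, inner_smul_left]
    rcases eq_or_ne c 0 with rfl | hc
    · simp
    · refine mul_eq_zero_of_right _ (ha _ (T.finite_dimensional_eigenspace hcomp c hc) ?_ b ?_)
      · intro g d hd
        rw [Module.End.mem_eigenspace_iff, ContinuousLinearMap.coe_coe] at hd ⊢
        rw [hT, averageRankOne_toHom_apply, ← hT, hd, map_smul]
      · rwa [Module.End.mem_eigenspace_iff]
  have hint : ∫ x, ‖(inner ℂ (π.toHom x a) a : ℂ)‖ ^ 2 ∂μ = 0 := by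
    have h := inner_averageRankOne_apply μ π π a a a a
    rw [← hT, hTa, inner_zero_right] at h
    have h2 : ∀ x, inner ℂ (π.toHom x a) a * inner ℂ a (π.toHom x a) =
        ((‖(inner ℂ (π.toHom x a) a : ℂ)‖ ^ 2 : ℝ) : ℂ) := fun x => by
      rw [← inner_conj_symm a, RCLike.mul_conj]; simp
    simp only [h2] at h
    rw [integral_complex_ofReal] at h
    exact_mod_cast h.symm
  have hcont : Continuous fun x => ‖(inner ℂ (π.toHom x a) a : ℂ)‖ ^ 2 :=
    (((π.continuous_apply a).inner continuous_const).norm.pow 2)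
  -- At `x = 1` the integrand is `‖a‖ ^ 4`, so a vanishing integral forces `a = 0`.
  have h0 := (Continuous.integral_pos_of_hasCompactSupport_nonneg_nonzero (μ := μ) (x := 1) hcont
    (HasCompactSupport.of_compactSpace _) (fun x => by positivity)).mt
  by_contra hne
  refine h0 ?_ ?_
  · rw [hint]; exact lt_irrefl _
  · simpa using hne

end Averaging

end UnitaryRep

namespace UnitaryRep

/-! ### Schur's lemma. -/

section Schur

variable {G : Type u} [Group G] [TopologicalSpace G]
variable {H : Type v} [NormedAddCommGroup H] [InnerProductSpace ℂ H]
variable {H' : Type v} [NormedAddCommGroup H'] [InnerProductSpace ℂ H']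

lemma IsIrreducible.eq_bot_or_eq_top [FiniteDimensional ℂ H] {π : UnitaryRep G H}
    (hπ : π.IsIrreducible) {K : Submodule ℂ H} (hK : π.IsInvariant K) : K = ⊥ ∨ K = ⊤ :=
  hπ.2 K K.closed_of_finiteDimensional hK

/-- **Schur's lemma** for self-intertwining operators. -/
theorem IsIrreducible.exists_eq_smul_id [FiniteDimensional ℂ H] {π : UnitaryRep G H}
    (hπ : π.IsIrreducible) (T : H →ₗ[ℂ] H) (hT : ∀ g a, T (π.toHom g a) = π.toHom g (T a)) :
    ∃ c : ℂ, ∀ a, T a = c • a := by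
  have := hπ.1
  obtain ⟨c, hc⟩ := Module.End.exists_eigenvalue T
  refine ⟨c, fun a => ?_⟩
  -- An eigenspace of an intertwiner is invariant; being nonzero, it is all of `H`.
  have h := (hπ.eq_bot_or_eq_top (K := Module.End.eigenspace T c) fun g a ha => by
    rw [Module.End.mem_eigenspace_iff] at ha ⊢
    rw [hT, ha, map_smul]).resolve_left hc
  exact Module.End.mem_eigenspace_iff.1 (h ▸ Submodule.mem_top)

/-- **Schur's lemma**: a nonzero operator intertwining irreducible unitary representations is a
multiple of a unitary equivalence. -/
theorem IsIrreducible.unitaryEquiv_of_ne_zero [FiniteDimensional ℂ H] [FiniteDimensional ℂ H']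
    {π : UnitaryRep G H} {π' : UnitaryRep G H'} (hπ : π.IsIrreducible) (hπ' : π'.IsIrreducible)
    (T : H →ₗ[ℂ] H') (hT : ∀ g a, T (π.toHom g a) = π'.toHom g (T a)) (hT0 : T ≠ 0) :
    π.UnitaryEquiv π' := by
  -- The adjoint intertwines in the other direction, so `T* T` is a scalar `c = r²` and `r⁻¹ T` is
  -- an isometry. Its range is invariant and nonzero, hence everything.
  have hadj : ∀ g b, T.adjoint (π'.toHom g b) = π.toHom g (T.adjoint b) := fun g b => by
    refine ext_inner_left ℂ fun a => ?_
    rw [LinearMap.adjoint_inner_right, inner_toHom_right, ← hT, inner_toHom_right,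
      LinearMap.adjoint_inner_right]
  obtain ⟨c, hc⟩ := hπ.exists_eq_smul_id (T.adjoint ∘ₗ T) fun g a => by simp [hT, hadj]
  have hnorm : ∀ a, ((‖T a‖ ^ 2 : ℝ) : ℂ) = c * ((‖a‖ ^ 2 : ℝ) : ℂ) := fun a => by
    have h := congrArg (inner ℂ a) (hc a)
    rw [LinearMap.comp_apply, LinearMap.adjoint_inner_right, inner_smul_right,
      inner_self_eq_norm_sq_to_K, inner_self_eq_norm_sq_to_K] at h
    exact_mod_cast h
  obtain ⟨a₀, ha₀⟩ : ∃ a, T a ≠ 0 := by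
    by_contra! h
    exact hT0 (LinearMap.ext h)
  have ha₀' : a₀ ≠ 0 := by rintro rfl; simp at ha₀
  set r : ℝ := ‖T a₀‖ / ‖a₀‖ with hr
  have hrpos : 0 < r := div_pos (norm_pos_iff.2 ha₀) (norm_pos_iff.2 ha₀')
  have hcr : c = ((r ^ 2 : ℝ) : ℂ) := by
    have h0 : ((‖a₀‖ ^ 2 : ℝ) : ℂ) ≠ 0 := by simpa using ha₀'
    rw [hr, div_pow, Complex.ofReal_div, hnorm a₀]
    field_simp
  have hnorm' : ∀ a, ‖T a‖ = r * ‖a‖ := fun a => by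
    have h := hnorm a
    rw [hcr] at h
    norm_cast at h
    rw [← mul_pow] at h
    exact (pow_left_inj₀ (norm_nonneg _) (by positivity) two_ne_zero).1 h
  have hsurj : LinearMap.range T = ⊤ := by
    refine (hπ'.eq_bot_or_eq_top (K := LinearMap.range T) ?_).resolve_left fun h => hT0 ?_
    · rintro g _ ⟨a, rfl⟩
      exact ⟨π.toHom g a, hT g a⟩
    · exact LinearMap.range_eq_bot.1 h
  have hrC : (r : ℂ) ≠ 0 := by exact_mod_cast hrpos.ne'
  let S : H →ₗᵢ[ℂ] H' :=
    { toLinearMap := (r : ℂ)⁻¹ • T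
      norm_map' a := by simp [norm_smul, hnorm', abs_of_pos hrpos, hrpos.ne'] }
  refine ⟨LinearIsometryEquiv.ofSurjective S fun b => ?_, fun g a => ?_⟩
  · obtain ⟨a, ha⟩ := LinearMap.range_eq_top.1 hsurj b
    exact ⟨(r : ℂ) • a, by
      change (r : ℂ)⁻¹ • T ((r : ℂ) • a) = b
      rw [map_smul, ha, inv_smul_smul₀ hrC]⟩
  · change (r : ℂ)⁻¹ • T _ = π'.toHom g ((r : ℂ)⁻¹ • T a)
    rw [hT, map_smul]

end Schur

/-! ### Finite dimension of irreducibles and the orthogonality relations. -/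

section Orthogonality

variable {G : Type u} [Group G] [TopologicalSpace G] [IsTopologicalGroup G] [CompactSpace G]
  [MeasurableSpace G] [BorelSpace G] (μ : Measure G) [IsProbabilityMeasure μ]
variable {H : Type v} [NormedAddCommGroup H] [InnerProductSpace ℂ H]
variable {H' : Type v} [NormedAddCommGroup H'] [InnerProductSpace ℂ H']

/-- Irreducible unitary representations of compact groups on Hilbert spaces are
finite-dimensional. -/
theorem IsIrreducible.finiteDimensional [μ.IsMulLeftInvariant] [μ.IsOpenPosMeasure]
    [CompleteSpace H] {π : UnitaryRep G H} (hπ : π.IsIrreducible) : FiniteDimensional ℂ H := by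
  have := hπ.1
  obtain ⟨a, ha⟩ := exists_ne (0 : H)
  by_contra hfin
  refine ha (eq_zero_of_forall_mem_orthogonal μ π a fun K hK hinv => ?_)
  rcases hπ.2 K K.closed_of_finiteDimensional hinv with rfl | rfl
  · simp
  · exact absurd (Module.Finite.equiv (Submodule.topEquiv (R := ℂ) (M := H))) hfin

-- Turns `L²` inner products of coefficients into matrix entries of an intertwiner, where Schur's
-- lemma applies.
omit [IsTopologicalGroup G] in
lemma inner_toLp_matrixCoeff [CompleteSpace H'] (π : UnitaryRep G H) (π' : UnitaryRep G H')
    (a b : H) (a' b' : H') :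
    inner ℂ (ContinuousMap.toLp 2 μ ℂ (π.matrixCoeff a b))
      (ContinuousMap.toLp 2 μ ℂ (π'.matrixCoeff a' b')) =
      inner ℂ b' (averageRankOne μ π π' a a' b) := by
  rw [ContinuousMap.inner_toLp, inner_averageRankOne_apply]
  simp [mul_comm]

variable [μ.IsMulLeftInvariant]

/-- **Schur orthogonality** for inequivalent representations. -/
theorem inner_toLp_matrixCoeff_of_not_unitaryEquiv [FiniteDimensional ℂ H] [FiniteDimensional ℂ H']
    {π : UnitaryRep G H} {π' : UnitaryRep G H'} (hπ : π.IsIrreducible) (hπ' : π'.IsIrreducible)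
    (h : ¬ π.UnitaryEquiv π') (a b : H) (a' b' : H') :
    inner ℂ (ContinuousMap.toLp 2 μ ℂ (π.matrixCoeff a b))
      (ContinuousMap.toLp 2 μ ℂ (π'.matrixCoeff a' b')) = 0 := by
  have := FiniteDimensional.complete ℂ H'
  have h0 : (averageRankOne μ π π' a a' : H →ₗ[ℂ] H') = 0 := by
    by_contra h0
    exact h (hπ.unitaryEquiv_of_ne_zero hπ' _ (averageRankOne_toHom_apply μ π π' a a') h0)
  rw [inner_toLp_matrixCoeff, ← ContinuousLinearMap.coe_coe, h0]
  simp

-- The trace passes through the integral, and unitarity makes the trace of the integrand constant.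
-- This fixes the scalar left open by Schur's lemma.
omit [IsTopologicalGroup G] [μ.IsMulLeftInvariant] in
lemma trace_averageRankOne [FiniteDimensional ℂ H] (π : UnitaryRep G H) (a a' : H) :
    LinearMap.trace ℂ H (averageRankOne μ π π a a') = inner ℂ a a' := by
  have := FiniteDimensional.complete ℂ H
  have : FiniteDimensional ℂ (H →L[ℂ] H) := inferInstance
  let tr : (H →L[ℂ] H) →L[ℂ] ℂ :=
    LinearMap.toContinuousLinearMap (LinearMap.trace ℂ H ∘ₗ ContinuousLinearMap.coeLM ℂ)
  change tr (averageRankOne μ π π a a') = _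
  rw [averageRankOne,
    ← tr.integral_comp_comm (integrable_of_continuous μ (continuous_rankOne π π a a'))]
  have h : ∀ x, tr (InnerProductSpace.rankOne ℂ (π.toHom x a') (π.toHom x a)) = inner ℂ a a' :=
    fun x => by
      change LinearMap.trace ℂ H (InnerProductSpace.rankOne ℂ (π.toHom x a') (π.toHom x a)) = _
      rw [InnerProductSpace.trace_rankOne, LinearIsometryEquiv.inner_map_map]
  simp [h]

/-- **Schur orthogonality** for one irreducible representation. -/
theorem inner_toLp_matrixCoeff_self [FiniteDimensional ℂ H] {π : UnitaryRep G H}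
    (hπ : π.IsIrreducible) (a b a' b' : H) :
    inner ℂ (ContinuousMap.toLp 2 μ ℂ (π.matrixCoeff a b))
      (ContinuousMap.toLp 2 μ ℂ (π.matrixCoeff a' b')) =
      (Module.finrank ℂ H : ℂ)⁻¹ * (inner ℂ a a' * inner ℂ b' b) := by
  have := FiniteDimensional.complete ℂ H
  have := hπ.1
  obtain ⟨c, hc⟩ := hπ.exists_eq_smul_id (averageRankOne μ π π a a' : H →ₗ[ℂ] H)
    (averageRankOne_toHom_apply μ π π a a')
  have htr := trace_averageRankOne μ π a a'
  have hid : (averageRankOne μ π π a a' : H →ₗ[ℂ] H) = c • LinearMap.id := LinearMap.ext hc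
  rw [hid, map_smul, LinearMap.trace_id, smul_eq_mul] at htr
  have hd : (Module.finrank ℂ H : ℂ) ≠ 0 := by exact_mod_cast Module.finrank_pos.ne'
  rw [inner_toLp_matrixCoeff, ← ContinuousLinearMap.coe_coe, hc, inner_smul_right, ← htr]
  field_simp

end Orthogonality

end UnitaryRep

/-! ### Unitarization of finite-dimensional representations. -/

section Unitarization

/-- Hiding the new inner product space behind an existential keeps its norm and topology apart from
a topology already present on `V`. -/
lemma InnerProductSpace.Core.exists_linearEquiv {V : Type v} [AddCommGroup V] [Module ℂ V]
    (c : InnerProductSpace.Core ℂ V) :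
    ∃ (H : Type v) (_ : NormedAddCommGroup H) (_ : InnerProductSpace ℂ H) (T : V ≃ₗ[ℂ] H),
      ∀ a b, inner ℂ (T a) (T b) = c.inner a b :=
  ⟨V, c.toNormedAddCommGroup, InnerProductSpace.ofCore c.toCore, LinearEquiv.refl ℂ V,
    fun _ _ => rfl⟩

variable {G : Type u} [Group G] [TopologicalSpace G] [IsTopologicalGroup G] [CompactSpace G]
  [MeasurableSpace G] [BorelSpace G]
variable {V : Type v} [AddCommGroup V] [Module ℂ V]
variable {E : Type*} [NormedAddCommGroup E] [InnerProductSpace ℂ E]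

/-- The inner product obtained by averaging over the group. -/
@[reducible]
noncomputable def Representation.averagedCore (μ : Measure G) [IsProbabilityMeasure μ]
    [μ.IsOpenPosMeasure] (ρ : Representation ℂ G V) (e : V ≃ₗ[ℂ] E)
    (hc : ∀ a, Continuous fun g => e (ρ g a)) : InnerProductSpace.Core ℂ V where
  -- Since `x⁻¹g = (g⁻¹x)⁻¹`, the inverse lets left invariance of `μ` yield invariance of the form.
  inner a b := ∫ x, inner ℂ (e (ρ x⁻¹ a)) (e (ρ x⁻¹ b)) ∂μ
  conj_inner_symm a b := by rw [← integral_conj]; simp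
  re_inner_nonneg a := by
    simp only [inner_self_eq_norm_sq_to_K]
    norm_cast
    exact integral_nonneg fun x => by positivity
  add_left a b c := by
    have hc' : ∀ a, Continuous fun g => e (ρ g⁻¹ a) := fun a => (hc a).comp continuous_inv
    rw [← integral_add (UnitaryRep.integrable_of_continuous μ ((hc' a).inner (hc' c)))
      (UnitaryRep.integrable_of_continuous μ ((hc' b).inner (hc' c)))]
    simp
  smul_left a b r := by
    simp [mul_comm _ ((starRingEnd ℂ) r), integral_const_mul]
  definite a h := by
    have hc' : Continuous fun g => ‖e (ρ g⁻¹ a)‖ ^ 2 := ((hc a).comp continuous_inv).norm.pow 2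
    simp only [inner_self_eq_norm_sq_to_K] at h
    norm_cast at h
    replace h := RCLike.ofReal_eq_zero.1 h
    by_contra hne
    refine (Continuous.integral_pos_of_hasCompactSupport_nonneg_nonzero (μ := μ) (x := 1) hc'
      (HasCompactSupport.of_compactSpace _) (fun x => by positivity) ?_).ne' h
    simpa using hne

lemma Representation.averagedCore_inner_apply_apply (μ : Measure G)
    [IsProbabilityMeasure μ] [μ.IsOpenPosMeasure] [μ.IsMulLeftInvariant] (ρ : Representation ℂ G V) (e : V ≃ₗ[ℂ] E)
    (hc : ∀ a, Continuous fun g => e (ρ g a)) (g : G) (a b : V) :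
    (ρ.averagedCore μ e hc).inner (ρ g a) (ρ g b) = (ρ.averagedCore μ e hc).inner a b := by
  change ∫ x, inner ℂ (e (ρ x⁻¹ (ρ g a))) (e (ρ x⁻¹ (ρ g b))) ∂μ = ∫ x, _ ∂μ
  rw [← integral_mul_left_eq_self _ g]
  simp only [← Module.End.mul_apply, ← map_mul]
  simp

/-- Every continuous finite-dimensional representation of a compact group is unitarizable. -/
theorem Representation.exists_unitaryRep [TopologicalSpace V] [IsTopologicalAddGroup V]
    [ContinuousSMul ℂ V] [T2Space V] [FiniteDimensional ℂ V] (μ : Measure G) [IsProbabilityMeasure μ]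
    [μ.IsMulLeftInvariant] [μ.IsOpenPosMeasure] (ρ : Representation ℂ G V)
    (hρ : ∀ a : V, Continuous fun g : G => ρ g a) :
    ∃ (H : Type v) (_ : NormedAddCommGroup H) (_ : InnerProductSpace ℂ H)
      (_ : FiniteDimensional ℂ H) (π : UnitaryRep G H) (T : V ≃L[ℂ] H),
      ∀ (g : G) (a : V), T (ρ g a) = π.toHom g (T a) := by
  -- Arbitrary linear coordinates supply the inner product to be averaged; they are continuous
  -- because `V` is finite-dimensional.
  obtain ⟨e⟩ : Nonempty (V ≃ₗ[ℂ] EuclideanSpace ℂ (Fin (Module.finrank ℂ V))) :=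
    FiniteDimensional.nonempty_linearEquiv_of_finrank_eq (by simp)
  have he : Continuous e := e.toLinearMap.continuous_of_finiteDimensional
  have hc : ∀ a, Continuous fun g => e (ρ g a) := fun a => he.comp (hρ a)
  obtain ⟨H, _, _, T, hT⟩ := (ρ.averagedCore μ e hc).exists_linearEquiv
  have : FiniteDimensional ℂ H := Module.Finite.equiv T
  refine ⟨H, _, _, ‹_›, UnitaryRep.ofRepresentation
    { toFun g := T.toLinearMap ∘ₗ ρ g ∘ₗ T.symm.toLinearMap
      map_one' := by ext; simp
      map_mul' g h := by ext; simp } (fun g a => ?_) (fun a => ?_),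
    T.toContinuousLinearEquiv, fun g a => by simp⟩
  · obtain ⟨a, rfl⟩ := T.surjective a
    have h := hT (ρ g a) (ρ g a)
    rw [ρ.averagedCore_inner_apply_apply μ, ← hT] at h
    change ‖T (ρ g (T.symm (T a)))‖ = ‖T a‖
    rw [T.symm_apply_apply, norm_eq_sqrt_re_inner (𝕜 := ℂ), h, ← norm_eq_sqrt_re_inner (𝕜 := ℂ)]
  · exact T.toContinuousLinearEquiv.continuous.comp (hρ _)

end Unitarization

/-! ### The algebra of matrix coefficients and its density. -/

section MatrixCoeffSpan

open UnitaryRep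

variable {G : Type u} [Group G] [TopologicalSpace G]

/-- The trivial representation. -/
noncomputable def UnitaryRep.trivial (H : Type v) [NormedAddCommGroup H] [InnerProductSpace ℂ H] :
    UnitaryRep G H where
  toHom := 1
  continuous_apply _ := continuous_const

/-- The space `H` may lie in any universe: transport to a Euclidean space over a `ULift`ed index set
lands in the universe `v` of the span. -/
lemma UnitaryRep.matrixCoeff_mem_matrixCoeffSpan {H : Type*} [NormedAddCommGroup H]
    [InnerProductSpace ℂ H] [FiniteDimensional ℂ H] (π : UnitaryRep G H) (a b : H) :
    π.matrixCoeff a b ∈ matrixCoeffSpan.{u, v} G := by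
  let e : H ≃ₗᵢ[ℂ] EuclideanSpace ℂ (ULift.{v} (Fin (Module.finrank ℂ H))) :=
    ((stdOrthonormalBasis ℂ H).reindex Equiv.ulift.symm).repr
  rw [← π.matrixCoeff_transport e]
  exact Submodule.subset_span ⟨_, _, _, inferInstance, _, _, _, rfl⟩

lemma mul_mem_matrixCoeffSpan {f g : C(G, ℂ)} (hf : f ∈ matrixCoeffSpan.{u, v} G)
    (hg : g ∈ matrixCoeffSpan.{u, v} G) : f * g ∈ matrixCoeffSpan.{u, v} G := by
  induction hf using Submodule.span_induction with
  | mem f hf =>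
    obtain ⟨V, _, _, _, π, a, b, rfl⟩ := hf
    induction hg using Submodule.span_induction with
    | mem g hg =>
      obtain ⟨V', _, _, _, π', a', b', rfl⟩ := hg
      rw [← matrixCoeff_tensor]
      exact matrixCoeff_mem_matrixCoeffSpan _ _ _
    | zero => simp
    | add g h _ _ hg hh => rw [mul_add]; exact add_mem hg hh
    | smul c g _ hg => rw [mul_smul_comm]; exact Submodule.smul_mem _ _ hg
  | zero => simp
  | add g h _ _ hg hh => rw [add_mul]; exact add_mem hg hh
  | smul c g _ hg => rw [smul_mul_assoc]; exact Submodule.smul_mem _ _ hg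

lemma star_mem_matrixCoeffSpan {f : C(G, ℂ)} (hf : f ∈ matrixCoeffSpan.{u, v} G) :
    star f ∈ matrixCoeffSpan.{u, v} G := by
  induction hf using Submodule.span_induction with
  | mem f hf =>
    obtain ⟨V, _, _, _, π, a, b, rfl⟩ := hf
    have := FiniteDimensional.complete ℂ V
    have : FiniteDimensional ℂ (StrongDual ℂ V) := inferInstance
    rw [← matrixCoeff_dual]
    exact matrixCoeff_mem_matrixCoeffSpan _ _ _
  | zero => simp
  | add g h _ _ hg hh => rw [star_add]; exact add_mem hg hh
  | smul c g _ hg => rw [star_smul]; exact Submodule.smul_mem _ _ hg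

lemma one_mem_matrixCoeffSpan : (1 : C(G, ℂ)) ∈ matrixCoeffSpan.{u, v} G := by
  have h := (UnitaryRep.trivial (G := G) ℂ).matrixCoeff_mem_matrixCoeffSpan.{u, v} 1 1
  convert h using 1
  ext x
  simp [UnitaryRep.trivial]

variable (G) in
/-- The star subalgebra of matrix coefficients of finite-dimensional unitary representations. -/
noncomputable def matrixCoeffStarSubalgebra : StarSubalgebra ℂ C(G, ℂ) where
  carrier := matrixCoeffSpan.{u, v} G
  mul_mem' := mul_mem_matrixCoeffSpan
  add_mem' := add_mem
  algebraMap_mem' c := by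
    rw [Algebra.algebraMap_eq_smul_one]
    exact Submodule.smul_mem _ _ one_mem_matrixCoeffSpan
  star_mem' := star_mem_matrixCoeffSpan

@[simp]
lemma coe_matrixCoeffStarSubalgebra :
    (matrixCoeffStarSubalgebra.{u, v} G : Set C(G, ℂ)) = matrixCoeffSpan.{u, v} G := rfl

/-- Finite-dimensional unitary representations separate the points of a compact group. -/
theorem separatesPoints_matrixCoeffStarSubalgebra [IsTopologicalGroup G] [CompactSpace G]
    [T2Space G] [MeasurableSpace G] [BorelSpace G] (μ : Measure G) [μ.IsMulLeftInvariant]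
    [μ.IsOpenPosMeasure] [IsProbabilityMeasure μ] [μ.Regular] :
    (matrixCoeffStarSubalgebra.{u, v} G).toSubalgebra.SeparatesPoints := by
  intro x y hxy
  by_contra! hcon
  have hmem : ∀ f ∈ matrixCoeffSpan.{u, v} G, f x = f y := fun f hf =>
    hcon _ ⟨f, hf, rfl⟩
  set π := regular μ
  have hK : ∀ K : Submodule ℂ (Lp ℂ 2 μ), FiniteDimensional ℂ K → π.IsInvariant K →
      ∀ a ∈ K, π.toHom x a = π.toHom y a := fun K _ hinv a ha => by
    have h : (π.restrict K hinv).toHom x ⟨a, ha⟩ = (π.restrict K hinv).toHom y ⟨a, ha⟩ :=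
      ext_inner_left ℂ fun b =>
        hmem _ ((π.restrict K hinv).matrixCoeff_mem_matrixCoeffSpan ⟨a, ha⟩ b)
    exact congrArg Subtype.val h
  -- By `hK`, `π(x)` and `π(y)` agree on finite-dimensional invariant subspaces. Passing to adjoints
  -- puts the difference of `π(x⁻¹)a` and `π(y⁻¹)a` in the orthogonal complement of each of these.
  have hall : ∀ a, π.toHom x⁻¹ a = π.toHom y⁻¹ a := fun a => by
    rw [← sub_eq_zero]
    refine eq_zero_of_forall_mem_orthogonal μ π _ fun K hfin hinv b hb => ?_
    rw [inner_sub_right, inner_toHom_right, inner_toHom_right, inv_inv, inv_inv, hK K hfin hinv b hb,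
      sub_self]
  -- The translates `z ↦ F(xz)` and `z ↦ F(yz)` of a Urysohn function agree almost everywhere, hence
  -- everywhere by continuity; `z = 1` gives `0 = 1`.
  obtain ⟨f, hf0, hf1, -⟩ := exists_continuous_zero_one_of_isClosed (isClosed_singleton (x := x))
    (isClosed_singleton (x := y)) (by simpa using hxy)
  let F : C(G, ℂ) := ⟨fun z => (f z : ℂ), by fun_prop⟩
  have hae : (fun z => F (x⁻¹⁻¹ * z)) =ᵐ[μ] fun z => F (y⁻¹⁻¹ * z) :=
    (regular_toLp_ae_eq μ x⁻¹ F).symm.trans (hall _ ▸ regular_toLp_ae_eq μ y⁻¹ F)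
  have heq := (Continuous.ae_eq_iff_eq μ (by fun_prop) (by fun_prop)).1 hae
  have h1 := congrFun heq 1
  simp [F, hf0 (Set.mem_singleton x), hf1 (Set.mem_singleton y)] at h1

theorem topologicalClosure_matrixCoeffStarSubalgebra [IsTopologicalGroup G] [CompactSpace G]
    [T2Space G] [MeasurableSpace G] [BorelSpace G] (μ : Measure G) [μ.IsMulLeftInvariant]
    [μ.IsOpenPosMeasure] [IsProbabilityMeasure μ] [μ.Regular] :
    (matrixCoeffStarSubalgebra.{u, v} G).topologicalClosure = ⊤ :=
  ContinuousMap.starSubalgebra_topologicalClosure_eq_top_of_separatesPoints _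
    (separatesPoints_matrixCoeffStarSubalgebra μ)

/-- Matrix coefficients of finite-dimensional unitary representations are linear combinations of
matrix coefficients of irreducible ones. -/
theorem UnitaryRep.matrixCoeff_mem_span_irreducible {H : Type v} [NormedAddCommGroup H]
    [InnerProductSpace ℂ H] [FiniteDimensional ℂ H] (π : UnitaryRep G H) (a b : H) :
    π.matrixCoeff a b ∈ Submodule.span ℂ
      {f | ∃ (σ : IrredUnitaryRep.{u, v} G) (c d : σ.space), f = σ.rep.matrixCoeff c d} := by
  induction hn : Module.finrank ℂ H using Nat.strong_induction_on generalizing H with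
  | _ n ih =>
  have := FiniteDimensional.complete ℂ H
  by_cases hirr : π.IsIrreducible
  · exact Submodule.subset_span ⟨⟨H, π, hirr⟩, a, b, rfl⟩
  rcases subsingleton_or_nontrivial H with hsub | hnt
  · convert Submodule.zero_mem _
    ext x
    simp [Subsingleton.elim b 0]
  obtain ⟨K, hinv, hbot, htop⟩ : ∃ K : Submodule ℂ H, π.IsInvariant K ∧ K ≠ ⊥ ∧ K ≠ ⊤ := by
    by_contra! h
    refine hirr ⟨hnt, fun K _ hinv => ?_⟩
    by_cases hb : K = ⊥
    · exact Or.inl hb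
    · exact Or.inr (h K hinv hb)
  have hlt : Module.finrank ℂ K < n := hn ▸ Submodule.finrank_lt htop
  have hlt' : Module.finrank ℂ Kᗮ < n :=
    hn ▸ Submodule.finrank_lt (by rwa [Ne, Submodule.orthogonal_eq_top_iff])
  obtain ⟨a₁, ha₁, a₂, ha₂, rfl⟩ := K.exists_add_mem_mem_orthogonal a
  obtain ⟨b₁, hb₁, b₂, hb₂, rfl⟩ := K.exists_add_mem_mem_orthogonal b
  -- Both `K` and its complement are invariant of smaller dimension, and the cross terms of the
  -- coefficient vanish.
  have h1 := ih _ hlt (π.restrict K hinv) ⟨a₁, ha₁⟩ ⟨b₁, hb₁⟩ rfl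
  have h2 := ih _ hlt' (π.restrict Kᗮ hinv.orthogonal) ⟨a₂, ha₂⟩ ⟨b₂, hb₂⟩ rfl
  rw [matrixCoeff_restrict] at h1 h2
  convert add_mem h1 h2 using 1
  ext x
  have e1 : inner ℂ b₁ (π.toHom x a₂) = 0 := hinv.orthogonal x a₂ ha₂ b₁ hb₁
  have e2 : inner ℂ b₂ (π.toHom x a₁) = 0 :=
    Submodule.inner_left_of_mem_orthogonal (hinv x a₁ ha₁) hb₂
  simp [e1, e2]

end MatrixCoeffSpan

/-! ### Isometries out of tensor products. -/

section TensorProduct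

variable {H K H' K' L : Type*} [NormedAddCommGroup H] [InnerProductSpace ℂ H]
  [NormedAddCommGroup K] [InnerProductSpace ℂ K] [NormedAddCommGroup H'] [InnerProductSpace ℂ H']
  [NormedAddCommGroup K'] [InnerProductSpace ℂ K'] [NormedAddCommGroup L] [InnerProductSpace ℂ L]

/-- A linear map on a tensor product that preserves inner products of pure tensors is isometric. -/
noncomputable def TensorProduct.isometryOfInnerTmul (T : H ⊗[ℂ] K →ₗ[ℂ] L)
    (h : ∀ a b a' b', inner ℂ (T (a ⊗ₜ b)) (T (a' ⊗ₜ b')) = inner ℂ a a' * inner ℂ b b') :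
    H ⊗[ℂ] K →ₗᵢ[ℂ] L :=
  T.isometryOfInner fun x y => by
    induction x with
    | zero => simp
    | add x x' hx hx' => simp only [map_add, inner_add_left, hx, hx']
    | tmul a b =>
      induction y with
      | zero => simp
      | add y y' hy hy' => simp only [map_add, inner_add_right, hy, hy']
      | tmul a' b' => rw [TensorProduct.inner_tmul, h]

lemma TensorProduct.inner_map_map_eq_zero (T : H ⊗[ℂ] K →ₗᵢ[ℂ] L) (T' : H' ⊗[ℂ] K' →ₗᵢ[ℂ] L)
    (h : ∀ a b a' b', inner ℂ (T (a ⊗ₜ b)) (T' (a' ⊗ₜ b')) = 0) (x : H ⊗[ℂ] K) (y : H' ⊗[ℂ] K') :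
    inner ℂ (T x) (T' y) = 0 := by
  induction x with
  | zero => simp
  | add x x' hx hx' => simp only [map_add, inner_add_left, hx, hx', add_zero]
  | tmul a b =>
    induction y with
    | zero => simp
    | add y y' hy hy' => simp only [map_add, inner_add_right, hy, hy', add_zero]
    | tmul a' b' => exact h a b a' b'

-- In finite dimension the algebraic tensor product is already the Hilbert tensor product; the
-- Hilbert sum needs this completeness.
variable (H K) in
lemma TensorProduct.completeSpace_of_finiteDimensional [FiniteDimensional ℂ H]
    [FiniteDimensional ℂ K] : CompleteSpace (H ⊗[ℂ] K) :=
  FiniteDimensional.complete ℂ (H ⊗[ℂ] K)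

end TensorProduct

/-! ### Normalized coefficients of representatives and their completeness. -/

section PeterWeyl

open UnitaryRep

variable {G : Type u} [Group G] [TopologicalSpace G]

lemma UnitaryRep.matrixCoeff_map_of_intertwining {H H' : Type*} [NormedAddCommGroup H]
    [InnerProductSpace ℂ H] [NormedAddCommGroup H'] [InnerProductSpace ℂ H']
    (π : UnitaryRep G H) (π' : UnitaryRep G H') (T : H ≃ₗᵢ[ℂ] H')
    (hT : ∀ g a, T (π.toHom g a) = π'.toHom g (T a)) (a b : H) :
    π'.matrixCoeff (T a) (T b) = π.matrixCoeff a b := by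
  ext x; simp [← hT]

/-- A choice of representatives of the unitary dual accounts for all matrix coefficients. -/
lemma matrixCoeffSpan_le_span_representatives
    (R : UnitaryDual.{u, v} G → IrredUnitaryRep.{u, v} G) (hR : ∀ σ, (R σ).toUnitaryDual = σ) :
    matrixCoeffSpan.{u, v} G ≤ Submodule.span ℂ
      {f | ∃ (σ : UnitaryDual.{u, v} G) (a b : (R σ).space), f = (R σ).rep.matrixCoeff a b} := by
  refine Submodule.span_le.2 ?_
  rintro _ ⟨V, _, _, _, π, a, b, rfl⟩
  refine Submodule.span_le.2 ?_ (π.matrixCoeff_mem_span_irreducible a b)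
  rintro _ ⟨τ, c, d, rfl⟩
  obtain ⟨T, hT⟩ : τ.rep.UnitaryEquiv (R τ.toUnitaryDual).rep :=
    Quotient.exact (hR τ.toUnitaryDual).symm
  exact Submodule.subset_span
    ⟨τ.toUnitaryDual, T c, T d, (matrixCoeff_map_of_intertwining _ _ T hT c d).symm⟩

lemma not_unitaryEquiv_representatives
    {R : UnitaryDual.{u, v} G → IrredUnitaryRep.{u, v} G} (hR : ∀ σ, (R σ).toUnitaryDual = σ)
    {σ τ : UnitaryDual.{u, v} G} (hστ : σ ≠ τ) : ¬ (R σ).rep.UnitaryEquiv (R τ).rep := fun h =>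
  hστ (by rw [← hR σ, ← hR τ]; exact Quotient.sound h)

variable [IsTopologicalGroup G] [CompactSpace G] [MeasurableSpace G] [BorelSpace G]
  (μ : Measure G) [IsProbabilityMeasure μ]

/-- The normalized matrix coefficient `√d ⟨π(·)a, b⟩` in `L²(G)`. -/
noncomputable def IrredUnitaryRep.normalizedCoeff (σ : IrredUnitaryRep.{u, v} G)
    (a b : σ.space) : Lp ℂ 2 μ :=
  ((√(Module.finrank ℂ σ.space : ℝ) : ℝ) : ℂ) • ContinuousMap.toLp 2 μ ℂ (σ.rep.matrixCoeff a b)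

namespace IrredUnitaryRep

variable [μ.IsMulLeftInvariant]

/-- The two factors `√d` cancel the `1/d` of Schur orthogonality. -/
lemma inner_normalizedCoeff_self (σ : IrredUnitaryRep.{u, v} G) [FiniteDimensional ℂ σ.space]
    (a b a' b' : σ.space) :
    inner ℂ (σ.normalizedCoeff μ a b) (σ.normalizedCoeff μ a' b') =
      inner ℂ a a' * inner ℂ b' b := by
  have := σ.irreducible.1
  have hd : (Module.finrank ℂ σ.space : ℂ) ≠ 0 := by exact_mod_cast Module.finrank_pos.ne'
  have hs : ((√(Module.finrank ℂ σ.space : ℝ) : ℝ) : ℂ) * ((√(Module.finrank ℂ σ.space : ℝ) : ℝ) : ℂ)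
      = Module.finrank ℂ σ.space := by
    rw [← Complex.ofReal_mul, Real.mul_self_sqrt (Nat.cast_nonneg _), Complex.ofReal_natCast]
  rw [normalizedCoeff, normalizedCoeff, inner_smul_left, inner_smul_right,
    inner_toLp_matrixCoeff_self μ σ.irreducible, Complex.conj_ofReal, ← mul_assoc, ← mul_assoc, hs,
    mul_inv_cancel₀ hd, one_mul]

lemma inner_normalizedCoeff_of_not_unitaryEquiv (σ τ : IrredUnitaryRep.{u, v} G)
    [FiniteDimensional ℂ σ.space] [FiniteDimensional ℂ τ.space]
    (h : ¬ σ.rep.UnitaryEquiv τ.rep) (a b : σ.space) (a' b' : τ.space) :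
    inner ℂ (σ.normalizedCoeff μ a b) (τ.normalizedCoeff μ a' b') = 0 := by
  rw [normalizedCoeff, normalizedCoeff, inner_smul_left, inner_smul_right,
    inner_toLp_matrixCoeff_of_not_unitaryEquiv μ σ.irreducible τ.irreducible h, mul_zero, mul_zero]

/-- The isometric embedding `H ⊗ H* → L²(G)` through normalized matrix coefficients. -/
noncomputable def tensorDualIsometry (σ : IrredUnitaryRep.{u, v} G) [FiniteDimensional ℂ σ.space] :
    σ.space ⊗[ℂ] StrongDual ℂ σ.space →ₗᵢ[ℂ] Lp ℂ 2 μ :=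
  TensorProduct.isometryOfInnerTmul (K := StrongDual ℂ σ.space)
    (TensorProduct.lift
      -- Linearity in `φ` comes from two conjugations: that of `toDual.symm` and that of the second
      -- slot of the coefficient.
      (LinearMap.mk₂ ℂ (fun a φ => σ.normalizedCoeff μ a ((InnerProductSpace.toDual ℂ _).symm φ))
        (fun a a' φ => by simp [normalizedCoeff, matrixCoeff_add_left])
        (fun c a φ => by
          rw [normalizedCoeff, matrixCoeff_smul_left, map_smul, smul_comm]
          rfl)
        (fun a φ ψ => by simp [normalizedCoeff, matrixCoeff_add_right])
        (fun c a φ => by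
          rw [map_smulₛₗ, normalizedCoeff, matrixCoeff_smul_right, map_smul, smul_comm]
          simp [normalizedCoeff])))
    (fun _ _ _ _ => inner_normalizedCoeff_self μ σ _ _ _ _)

lemma tensorDualIsometry_tmul_toDual (σ : IrredUnitaryRep.{u, v} G) [FiniteDimensional ℂ σ.space]
    (a b : σ.space) :
    σ.tensorDualIsometry μ (a ⊗ₜ InnerProductSpace.toDual ℂ σ.space b) =
      σ.normalizedCoeff μ a b := by
  change σ.normalizedCoeff μ a
    ((InnerProductSpace.toDual ℂ _).symm (InnerProductSpace.toDual ℂ σ.space b)) = _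
  rw [LinearIsometryEquiv.symm_apply_apply]

end IrredUnitaryRep

open IrredUnitaryRep

variable [T2Space G] [μ.IsMulLeftInvariant] [μ.IsOpenPosMeasure] [μ.Regular]

/-- A closed subspace of `L²(G)` containing the normalized matrix coefficients of representatives
of all classes in the unitary dual is everything. -/
lemma top_le_of_normalizedCoeff_mem
    (R : UnitaryDual.{u, v} G → IrredUnitaryRep.{u, v} G) (hR : ∀ σ, (R σ).toUnitaryDual = σ)
    (S : Submodule ℂ (Lp ℂ 2 μ)) (hS : ∀ σ a b, (R σ).normalizedCoeff μ a b ∈ S) :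
    ⊤ ≤ S.topologicalClosure := by
  have hdense : Dense (matrixCoeffSpan.{u, v} G : Set C(G, ℂ)) := by
    have h := topologicalClosure_matrixCoeffStarSubalgebra.{u, v} (G := G) μ
    rw [dense_iff_closure_eq, ← coe_matrixCoeffStarSubalgebra,
      ← StarSubalgebra.topologicalClosure_coe, h]
    rfl
  -- `C(G)` is dense in `L²(G)` and maps to it continuously, so uniform density passes to `L²`
  -- density.
  have himg := (ContinuousMap.toLp_denseRange ℂ μ ℂ (p := 2) (by simp)).dense_image
    (ContinuousMap.toLp 2 μ ℂ).continuous hdense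
  have hsub : ContinuousMap.toLp 2 μ ℂ '' (matrixCoeffSpan.{u, v} G : Set C(G, ℂ)) ⊆ S := by
    rw [Set.image_subset_iff]
    refine (matrixCoeffSpan_le_span_representatives R hR).trans
      (Submodule.span_le (p := S.comap (ContinuousMap.toLp 2 μ ℂ).toLinearMap).2 ?_)
    rintro _ ⟨σ, a, b, rfl⟩
    have := (R σ).irreducible.1
    have := (R σ).irreducible.finiteDimensional μ
    have hd : ((√(Module.finrank ℂ (R σ).space : ℝ) : ℝ) : ℂ) ≠ 0 := by
      have : 0 < Module.finrank ℂ (R σ).space := Module.finrank_pos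
      exact_mod_cast (Real.sqrt_pos.2 (by exact_mod_cast this)).ne'
    exact (S.smul_mem_iff hd).1 (hS σ a b)
  intro f _
  exact (himg.mono hsub) f

end PeterWeyl

/-! ### The Peter–Weyl theorem. -/

theorem theoremA1 {G : Type u} [Group G] [TopologicalSpace G] [IsTopologicalGroup G]
    [CompactSpace G] [T2Space G] [MeasurableSpace G] [BorelSpace G]
    (μ : Measure G) [μ.IsHaarMeasure] [IsProbabilityMeasure μ] [μ.Regular] :
    -- every finite-dimensional continuous representation is equivalent to a unitary one
    (∀ (V : Type v) [AddCommGroup V] [Module ℂ V] [TopologicalSpace V] [IsTopologicalAddGroup V]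
        [ContinuousSMul ℂ V] [T2Space V] [FiniteDimensional ℂ V] (ρ : Representation ℂ G V),
      (∀ a : V, Continuous fun g : G => ρ g a) →
      ∃ (H : Type v) (_ : NormedAddCommGroup H) (_ : InnerProductSpace ℂ H)
        (_ : FiniteDimensional ℂ H) (π : UnitaryRep G H) (T : V ≃L[ℂ] H),
        ∀ (g : G) (a : V), T (ρ g a) = π.toHom g (T a)) ∧
    -- the span of the matrix coefficients
    (∃ A : StarSubalgebra ℂ C(G, ℂ),
      (A : Set C(G, ℂ)) = matrixCoeffSpan.{u, v} G ∧
      (∀ c : ℂ, ContinuousMap.const G c ∈ A) ∧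
      A.toSubalgebra.SeparatesPoints ∧
      ∀ (f : C(G, ℂ)) (ε : ℝ), 0 < ε → ∃ a ∈ A, ∀ x : G, ‖f x - a x‖ < ε) ∧
    -- irreducible unitary representations are finite-dimensional
    (∀ σ : IrredUnitaryRep.{u, v} G, FiniteDimensional ℂ σ.space) ∧
    -- for each choice of representatives of the unitary dual
    (∀ R : UnitaryDual.{u, v} G → IrredUnitaryRep.{u, v} G, (∀ σ, (R σ).toUnitaryDual = σ) →
      -- the normalized matrix coefficients form an orthonormal basis
      (∀ (n : UnitaryDual.{u, v} G → ℕ)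
          (e : ∀ σ, OrthonormalBasis (Fin (n σ)) ℂ (R σ).space),
        ∃ B : HilbertBasis (Σ σ : UnitaryDual.{u, v} G, Fin (n σ) × Fin (n σ)) ℂ (Lp ℂ 2 μ),
          ∀ (σ : UnitaryDual.{u, v} G) (i j : Fin (n σ)),
            B ⟨σ, (i, j)⟩ = ((√(Module.finrank ℂ (R σ).space : ℝ) : ℝ) : ℂ) •
              ContinuousMap.toLp 2 μ ℂ ((R σ).rep.matrixCoeff (e σ i) (e σ j))) ∧
      -- the Hilbert direct sum decomposition, through the normalized matrix coefficients
      (letI := Classical.decEq (UnitaryDual.{u, v} G)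
      ∃ U : lp (fun σ : UnitaryDual.{u, v} G =>
          (R σ).space ⊗[ℂ] StrongDual ℂ (R σ).space) 2 ≃ₗᵢ[ℂ] Lp ℂ 2 μ,
        ∀ (σ : UnitaryDual.{u, v} G) (a b : (R σ).space),
          U (lp.single 2 σ (a ⊗ₜ[ℂ] InnerProductSpace.toDual ℂ (R σ).space b)) =
            ((√(Module.finrank ℂ (R σ).space : ℝ) : ℝ) : ℂ) •
              ContinuousMap.toLp 2 μ ℂ ((R σ).rep.matrixCoeff a b))) := by
  have hfin : ∀ σ : IrredUnitaryRep.{u, v} G, FiniteDimensional ℂ σ.space := fun σ =>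
    σ.irreducible.finiteDimensional μ
  refine ⟨fun V _ _ _ _ _ _ _ ρ hρ => ρ.exists_unitaryRep μ hρ,
    ⟨matrixCoeffStarSubalgebra.{u, v} G, coe_matrixCoeffStarSubalgebra, fun c => ?_,
      separatesPoints_matrixCoeffStarSubalgebra μ, fun f ε hε => ?_⟩, hfin, fun R hR => ⟨?_, ?_⟩⟩
  · exact algebraMap_mem (matrixCoeffStarSubalgebra.{u, v} G) c
  · have hf : f ∈ (matrixCoeffStarSubalgebra.{u, v} G).topologicalClosure := by
      rw [topologicalClosure_matrixCoeffStarSubalgebra μ]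
      trivial
    obtain ⟨a, ha, hfa⟩ := Metric.mem_closure_iff.1 hf ε hε
    refine ⟨a, ha, fun x => ?_⟩
    rw [← dist_eq_norm]
    exact (ContinuousMap.dist_apply_le_dist x).trans_lt hfa
  · intro n e
    have horth : Orthonormal ℂ fun i : (Σ σ : UnitaryDual.{u, v} G, Fin (n σ) × Fin (n σ)) =>
        (R i.1).normalizedCoeff μ (e i.1 i.2.1) (e i.1 i.2.2) := by
      classical
      rw [orthonormal_iff_ite]
      rintro ⟨σ, i, j⟩ ⟨τ, k, l⟩
      rcases eq_or_ne σ τ with rfl | hστ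
      · rw [IrredUnitaryRep.inner_normalizedCoeff_self, orthonormal_iff_ite.1 (e σ).orthonormal,
          orthonormal_iff_ite.1 (e σ).orthonormal]
        by_cases h1 : i = k <;> by_cases h2 : j = l <;> simp [h1, h2, eq_comm]
      · rw [IrredUnitaryRep.inner_normalizedCoeff_of_not_unitaryEquiv μ _ _
          (not_unitaryEquiv_representatives hR hστ), if_neg (fun h => hστ (congrArg Sigma.fst h))]
    refine ⟨HilbertBasis.mk horth (top_le_of_normalizedCoeff_mem μ R hR _ fun σ a b => ?_),
      fun σ i j => by rw [HilbertBasis.coe_mk]; rfl⟩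
    -- Completeness is known for coefficients of arbitrary vectors; sesquilinear expansion in the
    -- basis `e σ` reduces them to the chosen ones.
    have h : (R σ).normalizedCoeff μ a b = ∑ i, ∑ j, ((e σ).repr a i * star ((e σ).repr b j)) •
        (R σ).normalizedCoeff μ (e σ i) (e σ j) := by
      simp_rw [IrredUnitaryRep.normalizedCoeff, smul_comm _ ((√_ : ℝ) : ℂ), ← Finset.smul_sum,
        ← map_smul, ← map_sum]
      rw [← UnitaryRep.matrixCoeff_eq_sum, map_smul]
    rw [h]
    exact Submodule.sum_mem _ fun i _ => Submodule.sum_mem _ fun j _ =>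
      Submodule.smul_mem _ _ (Submodule.subset_span ⟨⟨σ, i, j⟩, rfl⟩)
  · have hsum : IsHilbertSum ℂ (fun σ : UnitaryDual.{u, v} G =>
        (R σ).space ⊗[ℂ] StrongDual ℂ (R σ).space) (fun σ => (R σ).tensorDualIsometry μ) := by
      have hcomp : ∀ σ, CompleteSpace ((R σ).space ⊗[ℂ] StrongDual ℂ (R σ).space) := fun σ =>
        TensorProduct.completeSpace_of_finiteDimensional _ (StrongDual ℂ (R σ).space)
      refine IsHilbertSum.mk (fun σ τ hστ x y => ?_)
        (top_le_of_normalizedCoeff_mem μ R hR _ fun σ a b => ?_)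
      · exact TensorProduct.inner_map_map_eq_zero (K := StrongDual ℂ (R σ).space)
          (K' := StrongDual ℂ (R τ).space) _ _ (fun _ _ _ _ =>
            IrredUnitaryRep.inner_normalizedCoeff_of_not_unitaryEquiv μ _ _
              (not_unitaryEquiv_representatives hR hστ) _ _ _ _) x y
      · rw [← IrredUnitaryRep.tensorDualIsometry_tmul_toDual]
        exact Submodule.mem_iSup_of_mem σ ⟨_, rfl⟩
    classical
    refine ⟨hsum.linearIsometryEquiv.symm, fun σ a b => ?_⟩
    rw [hsum.linearIsometryEquiv_symm_apply_single]
    exact IrredUnitaryRep.tensorDualIsometry_tmul_toDual μ (R σ) a b
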